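/- Let $k$ be an algebraically closed field of characteristic zero, $R=k[x_0,\dots,x_r]$ and $\bar R=k[x_1,\dots,x_r]$. Use the graded lexicographic order (GLex) with $x_0>x_1>\dots>x_r$ on both rings, and let $\mathrm{In}(J)$ be the initial ideal of an ideal $J$, generated by the leading terms of its elements. A homogeneous ideal $J$ of a polynomial ring in $n$ variables over $k$ is said to be in generic coordinates if $\mathrm{In}(J)$ is its generic initial ideal, that is, if there is a nonempty Zariski open set $U\subset GL_n(k)$, acting by linear changes of coordinates, with $\mathrm{In}(g(J))=\mathrm{In}(J)$ for all $g\in U$. For a nonzero homogeneous $f\in R$ let $d_0(f)$ be the exponent of $x_0$ in the leading monomial of $f$ (and $d_0(0)=0$). For $i\ge 0$ and a homogeneous ideal $I\subset R$ put $$\widetilde K_i(I)=\bigoplus_{d\ge 0}\{f\in I_d \mid d_0(f)\le i\}.$$ Each $f\in\widetilde K_i(I)$ is uniquely $f=x_0^i\bar f+g$ with $\bar f\in\bar R$ and only $x_0$-exponents smaller than $i$ in $g$. The $i$-th partial elimination ideal $K_i(I)\subset\bar R$ is the image of $\widetilde K_i(I)$ under $f\mapsto\bar f$. Let $I\subset R$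 be a homogeneous ideal in generic coordinates, and let $G$ be a (finite) Gröbner basis of $I$ with respect to GLex that consists of homogeneous polynomials. Then: (a) for every $i\ge 0$, the ideal $K_i(I)$ is homogeneous and in generic coordinates; (b) for every $i\ge 0$ such that $I_j=0$ for all $j<i$ (that is, for $0\le i\le\beta$, where $\beta=\min\{j\mid I_j\ne 0\}$, and for every $i\geq 0$ if $I=0$), the set $$G_i=\{\bar f \mid f\in G,\ f\neq 0,\ d_0(f)=i\}$$ is a Gröbner basis of $K_i(I)$ with respect to GLex, consisting of homogeneous polynomials. Here $\bar f$ is the coefficient of $x_0^i$ in $f$, so that $f=x_0^i\bar f+g$ as above. -/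

import Mathlib

namespace PartialElimination

open MvPolynomial

noncomputable section

/-- The initial ideal of `I` for the monomial order `m`: the ideal generated by the leading terms of
the elements of `I`. -/
def initialIdeal {σ k : Type*} [Field k] (m : MonomialOrder σ) (I : Ideal (MvPolynomial σ k)) :
    Ideal (MvPolynomial σ k) :=
  Ideal.span (m.leadingTerm '' (I : Set (MvPolynomial σ k)))

/-- A Gröbner basis of the (homogeneous) ideal `I` consisting of homogeneous polynomials: a finite
set of homogeneous elements of `I` whose leading terms generate the initial ideal of `I`. -/
def IsHomogeneousGroebnerBasis {σ k : Type*} [Field k] (m : MonomialOrder σ) (I : Ideal (MvPolynomial σ k))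
    (G : Set (MvPolynomial σ k)) : Prop :=
  G.Finite ∧ G ⊆ (I : Set (MvPolynomial σ k)) ∧ (∀ f ∈ G, ∃ d, f.IsHomogeneous d) ∧
    Ideal.span (m.leadingTerm '' G) = initialIdeal m I

/-- `I` is a homogeneous ideal for the standard grading. -/
def IsHomogeneousIdeal {σ k : Type*} [Field k] (I : Ideal (MvPolynomial σ k)) : Prop :=
  letI : GradedAlgebra (homogeneousSubmodule σ k) := MvPolynomial.gradedAlgebra
  I.IsHomogeneous (homogeneousSubmodule σ k)

/-- The action of `g ∈ GL_n(k)` on `k[x_0, …, x_{n-1}]` by the linear change of coordinates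
`x_j ↦ ∑ i, g_{ij} x_i`. -/
def changeCoords {n : ℕ} {k : Type*} [Field k] (g : GL (Fin n) k) :
    MvPolynomial (Fin n) k →ₐ[k] MvPolynomial (Fin n) k :=
  aeval fun j => ∑ i, C ((g : Matrix (Fin n) (Fin n) k) i j) * X i

/-- Zariski open subsets of `GL_n(k)`, seen inside the affine space of `n × n` matrices:
the complement in `GL_n(k)` of the common zeros of a set of polynomials in the matrix entries. -/
def IsZariskiOpen {n : ℕ} {k : Type*} [Field k] (U : Set (GL (Fin n) k)) : Prop :=
  ∃ J : Ideal (MvPolynomial (Fin n × Fin n) k),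
    U = {g : GL (Fin n) k |
      (fun p : Fin n × Fin n => (g : Matrix (Fin n) (Fin n) k) p.1 p.2) ∉ zeroLocus k J}

/-- `J` is the generic initial ideal of `I` for the graded lexicographic order with
`x_0 > x_1 > ⋯`: the initial ideal of `g(I)` is `J` for all `g` in a nonempty Zariski open subset
of `GL_n(k)`. -/
def IsGenericInitialIdeal {n : ℕ} {k : Type*} [Field k] (I J : Ideal (MvPolynomial (Fin n) k)) :
    Prop :=
  ∃ U : Set (GL (Fin n) k), IsZariskiOpen U ∧ U.Nonempty ∧
    ∀ g ∈ U, initialIdeal MonomialOrder.degLex (I.map (changeCoords g)) = J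

/-- `I` is in generic coordinates: its initial ideal (for the graded lexicographic order) is its
generic initial ideal. -/
def InGenericCoordinates {n : ℕ} {k : Type*} [Field k] (I : Ideal (MvPolynomial (Fin n) k)) :
    Prop :=
  IsGenericInitialIdeal I (initialIdeal MonomialOrder.degLex I)

/-- The exponent `d_0(f)` of `x_0` in the leading monomial of `f` for the graded lexicographic
order. -/
def d0 {r : ℕ} {k : Type*} [Field k] (f : MvPolynomial (Fin (r + 1)) k) : ℕ :=
  (MonomialOrder.degLex.degree f) 0

/-- The coefficient `f̄ ∈ k[x_1, …, x_r]` of `x_0 ^ i` in `f ∈ k[x_0, …, x_r]`; the variable `x_{j+1}`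
is `X j` in `MvPolynomial (Fin r) k`. If `f` is homogeneous with `d_0(f) ≤ i`, then no monomial of `f`
has `x_0`-exponent above `i`, so `f = x_0 ^ i f̄ + g` with `x_0`-exponents below `i` in `g`. -/
def bar {r : ℕ} {k : Type*} [Field k] (i : ℕ) (f : MvPolynomial (Fin (r + 1)) k) :
    MvPolynomial (Fin r) k :=
  (finSuccEquiv k r f).coeff i

/-- `⨁_d {f ∈ I_d | d_0(f) ≤ i}`, as a `k`-subspace of `k[x_0, …, x_r]`: the sums of homogeneous
elements `f` of `I` with `d_0(f) ≤ i`. -/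
def Ktilde {r : ℕ} {k : Type*} [Field k] (i : ℕ) (I : Ideal (MvPolynomial (Fin (r + 1)) k)) :
    Submodule k (MvPolynomial (Fin (r + 1)) k) :=
  Submodule.span k {f | f ∈ I ∧ (∃ d, f.IsHomogeneous d) ∧ d0 f ≤ i}

theorem finSuccEquiv_rename_succ {r : ℕ} {k : Type*} [Field k] (a : MvPolynomial (Fin r) k) :
    finSuccEquiv k r (rename Fin.succ a) = Polynomial.C a := by
  induction a using MvPolynomial.induction_on with
  | C c => simp [finSuccEquiv_apply]
  | add p q hp hq => simp [hp, hq]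
  | mul_X p j hp => rw [map_mul, map_mul, hp, rename_X, finSuccEquiv_X_succ, map_mul]

theorem d0_rename_mul_le {r : ℕ} {k : Type*} [Field k] (a : MvPolynomial (Fin r) k)
    (f : MvPolynomial (Fin (r + 1)) k) : d0 (rename Fin.succ a * f) ≤ d0 f := by
  classical
  by_cases ha : rename Fin.succ a = (0 : MvPolynomial (Fin (r + 1)) k)
  · simp [ha, d0]
  by_cases hf : f = 0
  · simp [hf]
  have h := MonomialOrder.degLex.degree_mem_support ha
  rw [support_rename_of_injective (Fin.succ_injective r), Finset.mem_image] at h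
  obtain ⟨b, -, hb⟩ := h
  have h0 : (MonomialOrder.degLex.degree
      (rename Fin.succ a : MvPolynomial (Fin (r + 1)) k)) 0 = 0 := by
    rw [← hb]
    exact Finsupp.mapDomain_of_notMem_range _ _ (by simp)
  unfold d0
  rw [MonomialOrder.degree_mul ha hf, Finsupp.add_apply, h0, zero_add]

theorem rename_mul_mem_Ktilde {r : ℕ} {k : Type*} [Field k] (i : ℕ)
    (I : Ideal (MvPolynomial (Fin (r + 1)) k)) (a : MvPolynomial (Fin r) k)
    {f : MvPolynomial (Fin (r + 1)) k} (hf : f ∈ Ktilde i I) :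
    rename Fin.succ a * f ∈ Ktilde i I := by
  induction hf using Submodule.span_induction with
  | mem f hf =>
    obtain ⟨hI, ⟨d, hd⟩, hi⟩ := hf
    rw [← sum_homogeneousComponent a, map_sum, Finset.sum_mul]
    refine Submodule.sum_mem _ fun e _ => Submodule.subset_span ⟨I.mul_mem_left _ hI, ?_, ?_⟩
    · exact ⟨_, (homogeneousComponent_isHomogeneous e a).rename_isHomogeneous.mul hd⟩
    · exact (d0_rename_mul_le _ _).trans hi
  | zero => simp
  | add f g _ _ hf hg => rw [mul_add]; exact add_mem hf hg
  | smul c f _ hf => rw [mul_smul_comm]; exact Submodule.smul_mem _ _ hf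

/-- The `i`-th partial elimination ideal `K_i(I) ⊆ k[x_1, …, x_r]`: the image of
`⨁_d {f ∈ I_d | d_0(f) ≤ i}` under `f ↦ f̄`. -/
def partialEliminationIdeal {r : ℕ} {k : Type*} [Field k] (i : ℕ)
    (I : Ideal (MvPolynomial (Fin (r + 1)) k)) : Ideal (MvPolynomial (Fin r) k) where
  carrier := {q | ∃ f ∈ Ktilde i I, bar i f = q}
  add_mem' := by
    rintro _ _ ⟨f, hf, rfl⟩ ⟨g, hg, rfl⟩
    exact ⟨f + g, add_mem hf hg, by simp [bar]⟩
  zero_mem' := ⟨0, zero_mem _, by simp [bar]⟩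
  smul_mem' := by
    rintro a _ ⟨f, hf, rfl⟩
    exact ⟨rename Fin.succ a * f, rename_mul_mem_Ktilde i I a hf,
      by simp [bar, finSuccEquiv_rename_succ]⟩

end

end PartialElimination

/-! Everything is read off from the set of leading exponents of `I`. Since GLex compares
`x_0`-exponents first within a degree, `s` is a leading exponent of `K_i(I)` exactly when `s.cons i`
is one of `I` (`mem_leadExps_partialEliminationIdeal`).

For (a), genericity must reach the subgroup of coordinate changes fixing `x_0`, which an arbitrary
nonempty open subset of `GL` could miss. It does, because `In(g(I)) = In(I)` holds on a
neighbourhood of the identity (`exists_polynomial_leadExps`): the number of leading exponents in an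
upper set of a fixed degree is the rank of a projection of `g(I)_d`. This rank is lower
semicontinuous in `g`, and generic coordinates make it maximal at `g = 1`. Forming `K_i` commutes
with the subgroup, so the neighbourhood restricts to one for `K_i(I)`.

For (b), the same maximality of ranks gives strong stability of `In(I)` in characteristic zero
(`add_single_mem_leadExps`). A leading monomial of `G` dividing `x_0^i x^s` may have too small an
`x_0`-exponent. As its degree is at least `i`, it contains another variable, which can be exchanged
for `x_0`. This lowers the degree of `s`, and induction ends at an element of `G` with `d_0 = i`. -/

namespace PartialElimination

open MvPolynomial

open scoped MonomialOrder

noncomputable section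

/-! ### Initial ideals through leading exponents -/

section LeadingExponents

variable {σ k : Type*} [Field k] (m : MonomialOrder σ)

/-- The exponents of the leading monomials of the nonzero elements of `I`. -/
def leadExps (I : Ideal (MvPolynomial σ k)) : Set (σ →₀ ℕ) :=
  {q | ∃ f ∈ I, f ≠ 0 ∧ m.degree f = q}

variable {m} {I J : Ideal (MvPolynomial σ k)}

theorem add_mem_leadExps {q s : σ →₀ ℕ} (hq : q ∈ leadExps m I) : q + s ∈ leadExps m I := by
  classical
  obtain ⟨f, hf, hf0, rfl⟩ := hq
  have hs : monomial s (1 : k) ≠ 0 := by simp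
  refine ⟨f * monomial s 1, I.mul_mem_right _ hf, mul_ne_zero hf0 hs, ?_⟩
  rw [m.degree_mul hf0 hs, m.degree_monomial, if_neg one_ne_zero]

theorem mem_leadExps_of_le {q s : σ →₀ ℕ} (hq : q ∈ leadExps m I) (hqs : q ≤ s) :
    s ∈ leadExps m I := by
  rw [← add_tsub_cancel_of_le hqs]
  exact add_mem_leadExps hq

theorem monomial_mem_span_leadingTerm_iff {B : Set (MvPolynomial σ k)} {q : σ →₀ ℕ} :
    monomial q (1 : k) ∈ Ideal.span (m.leadingTerm '' B) ↔ ∃ f ∈ B, f ≠ 0 ∧ m.degree f ≤ q := by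
  have : (fun p ↦ monomial (m.degree p) (1 : k)) '' (B \ {0}) =
      (fun s ↦ monomial s (1 : k)) '' (m.degree '' (B \ {0})) := by rw [Set.image_image]
  classical
  rw [m.span_leadingTerm_eq_span_monomial', this, mem_ideal_span_monomial_image]
  simp only [Set.mem_image, support_monomial, one_ne_zero, if_false,
    Finset.mem_singleton, forall_eq, Set.mem_sdiff, Set.mem_singleton_iff, and_assoc]
  constructor
  · rintro ⟨_, ⟨f, hf, hf0, rfl⟩, hq⟩
    exact ⟨f, hf, hf0, hq⟩
  · rintro ⟨f, hf, hf0, hq⟩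
    exact ⟨_, ⟨f, hf, hf0, rfl⟩, hq⟩

theorem monomial_mem_initialIdeal_iff {q : σ →₀ ℕ} :
    monomial q (1 : k) ∈ initialIdeal m I ↔ q ∈ leadExps m I := by
  rw [initialIdeal, monomial_mem_span_leadingTerm_iff]
  constructor
  · rintro ⟨f, hf, hf0, hq⟩
    exact mem_leadExps_of_le ⟨f, hf, hf0, rfl⟩ hq
  · rintro ⟨f, hf, hf0, rfl⟩
    exact ⟨f, hf, hf0, le_rfl⟩

theorem initialIdeal_eq_iff : initialIdeal m I = initialIdeal m J ↔ leadExps m I = leadExps m J := by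
  constructor
  · intro h
    ext q
    rw [← monomial_mem_initialIdeal_iff, h, monomial_mem_initialIdeal_iff]
  · intro h
    have key : ∀ I : Ideal (MvPolynomial σ k), initialIdeal m I =
        Ideal.span ((fun s ↦ monomial s (1 : k)) '' leadExps m I) := by
      intro I
      rw [initialIdeal, m.span_leadingTerm_eq_span_monomial']
      congr 1
      ext p
      simp only [leadExps, Set.mem_image, Set.mem_sdiff, SetLike.mem_coe, Set.mem_singleton_iff,
        Set.mem_ofPred_eq]
      constructor
      · rintro ⟨f, ⟨hf, hf0⟩, rfl⟩
        exact ⟨_, ⟨f, hf, hf0, rfl⟩, rfl⟩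
      · rintro ⟨_, ⟨f, hf, hf0, rfl⟩, rfl⟩
        exact ⟨f, ⟨hf, hf0⟩, rfl⟩
    rw [key, key, h]

theorem span_leadingTerm_eq_initialIdeal {G : Set (MvPolynomial σ k)} (hG : G ⊆ I)
    (h : ∀ q ∈ leadExps m I, ∃ f ∈ G, f ≠ 0 ∧ m.degree f ≤ q) :
    Ideal.span (m.leadingTerm '' G) = initialIdeal m I := by
  refine le_antisymm (Ideal.span_mono (Set.image_mono hG)) ?_
  rw [initialIdeal, m.span_leadingTerm_eq_span_monomial' (B := (I : Set (MvPolynomial σ k))),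
    Ideal.span_le]
  rintro _ ⟨f, ⟨hf, hf0⟩, rfl⟩
  exact monomial_mem_span_leadingTerm_iff.2 (h _ ⟨f, hf, hf0, rfl⟩)

/-- Finitely many leading exponents of `I` divide all the others. -/
theorem exists_finset_leadExps [Finite σ] (m : MonomialOrder σ) (I : Ideal (MvPolynomial σ k)) :
    ∃ S : Finset (σ →₀ ℕ), (S : Set (σ →₀ ℕ)) ⊆ leadExps m I ∧
      ∀ q ∈ leadExps m I, ∃ s ∈ S, s ≤ q := by
  have hfin : {q | Minimal (· ∈ leadExps m I) q}.Finite :=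
    WellQuasiOrderedLE.finite_of_isAntichain (setOfPred_minimal_antichain _)
  refine ⟨hfin.toFinset, fun q hq => ?_, fun q hq => ?_⟩
  · rw [Set.Finite.coe_toFinset] at hq
    exact hq.prop
  · obtain ⟨s, hs, hmin⟩ := exists_minimal_le_of_wellFoundedLT (· ∈ leadExps m I) q hq
    exact ⟨s, hfin.mem_toFinset.2 hmin, hs⟩

theorem isHomogeneousIdeal_iff : IsHomogeneousIdeal I ↔
    ∀ f ∈ I, ∀ d, homogeneousComponent d f ∈ I := by
  let : GradedAlgebra (homogeneousSubmodule σ k) := MvPolynomial.gradedAlgebra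
  constructor
  · intro h f hf d
    exact homogeneousComponent_mem_of_mem h hf d
  · intro h d f hf
    have := h f hf d
    rwa [← decomposition.decompose'_apply] at this

theorem exists_isHomogeneous_of_mem_leadExps (hI : IsHomogeneousIdeal I) {q : σ →₀ ℕ}
    (hq : q ∈ leadExps m I) :
    ∃ f ∈ I, f.IsHomogeneous q.degree ∧ f ≠ 0 ∧ m.degree f = q := by
  obtain ⟨f, hf, hf0, rfl⟩ := hq
  have hc : coeff (m.degree f) (homogeneousComponent (m.degree f).degree f) ≠ 0 := by
    rw [coeff_homogeneousComponent, if_pos rfl]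
    exact m.coeff_degree_ne_zero_iff.2 hf0
  refine ⟨_, isHomogeneousIdeal_iff.1 hI f hf (m.degree f).degree,
    homogeneousComponent_isHomogeneous _ _, fun h => hc (by rw [h, coeff_zero]), ?_⟩
  apply m.toSyn.injective
  refine le_antisymm (m.degree_le_degree_of_support_subset ?_)
    (m.le_degree (mem_support_iff.2 hc))
  rw [support_homogeneousComponent]
  exact Finset.filter_subset _ _

end LeadingExponents

/-! ### Counting leading exponents by ranks of coordinate projections -/

section Restriction

variable {σ k : Type*} [Field k] {m : MonomialOrder σ}

/-- The coefficients of a polynomial at the exponents in `T`. -/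
def restr (T : Finset (σ →₀ ℕ)) : MvPolynomial σ k →ₗ[k] (T → k) :=
  LinearMap.pi fun q => lcoeff k q.1

@[simp]
theorem restr_apply (T : Finset (σ →₀ ℕ)) (f : MvPolynomial σ k) (q : T) :
    restr T f q = coeff q.1 f := rfl

/-- The homogeneous elements of degree `d` of the ideal `I`. -/
def homPart (I : Ideal (MvPolynomial σ k)) (d : ℕ) : Submodule k (MvPolynomial σ k) :=
  I.restrictScalars k ⊓ homogeneousSubmodule σ k d

theorem mem_homPart {I : Ideal (MvPolynomial σ k)} {d : ℕ} {f : MvPolynomial σ k} :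
    f ∈ homPart I d ↔ f ∈ I ∧ f.IsHomogeneous d := Iff.rfl

/-- Triangularity: at the greatest index occurring in a relation, only the polynomial with that
leading exponent has a nonzero coefficient. -/
theorem linearIndependent_restr_of_degree {S T : Finset (σ →₀ ℕ)} (F : S → MvPolynomial σ k)
    (hF0 : ∀ q, F q ≠ 0) (hF : ∀ q, m.degree (F q) = q.1) (hST : S ⊆ T) :
    LinearIndependent k fun q => restr T (F q) := by
  classical
  rw [Fintype.linearIndependent_iff]
  intro g hg
  by_contra! hne
  obtain ⟨i, hi⟩ := hne
  obtain ⟨a, ha, hmax⟩ := (Finset.univ.filter fun q => g q ≠ 0).exists_max_image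
    (fun q => m.toSyn q.1) ⟨i, by simpa using hi⟩
  have h := congrFun hg ⟨a.1, hST a.2⟩
  rw [Finset.sum_apply, Finset.sum_eq_single a] at h
  · simp only [Pi.smul_apply, restr_apply, smul_eq_mul, Pi.zero_apply, mul_eq_zero] at h
    rcases h with h | h
    · simp [h] at ha
    · rw [← hF a, m.coeff_degree_eq_zero_iff] at h
      exact hF0 a h
  · intro b _ hba
    by_cases hb : g b = 0
    · simp [hb]
    · have hle := hmax b (by simpa using hb)
      have hlt : m.degree (F b) ≺[m] a.1 := by
        rw [hF]
        exact lt_of_le_of_ne hle fun h => hba (Subtype.ext (m.toSyn.injective h))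
      simp [m.coeff_eq_zero_of_lt hlt]
  · simp

-- Because `T` is closed upwards in degree `d`, an element of `I_d` that is nonzero on `T` has its
-- leading exponent in `T`. Hence the coefficients at the leading exponents in `T` already determine
-- the projection, which bounds the rank above; the triangular family bounds it below.
open Classical in
theorem finrank_map_restr {I : Ideal (MvPolynomial σ k)} (hI : IsHomogeneousIdeal I) {d : ℕ}
    {T : Finset (σ →₀ ℕ)} (hT : ∀ q ∈ T, q.degree = d)
    (hup : ∀ q ∈ T, ∀ q' : σ →₀ ℕ, q'.degree = d → q ≼[m] q' → q' ∈ T) :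
    Module.finrank k ((homPart I d).map (restr T)) = (T.filter (· ∈ leadExps m I)).card := by
  set S := T.filter (· ∈ leadExps m I) with hS
  have hST : S ⊆ T := Finset.filter_subset _ _
  have hF : ∀ q : S, ∃ f ∈ homPart I d, f ≠ 0 ∧ m.degree f = q.1 := by
    rintro ⟨q, hq⟩
    obtain ⟨hqT, hqL⟩ := Finset.mem_filter.1 hq
    obtain ⟨f, hf, hfd, hf0, hfq⟩ := exists_isHomogeneous_of_mem_leadExps hI hqL
    exact ⟨f, ⟨hf, hT q hqT ▸ hfd⟩, hf0, hfq⟩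
  choose F hFI hF0 hFq using hF
  have hli := linearIndependent_restr_of_degree F hF0 hFq hST
  apply le_antisymm
  · let ρ : (T → k) →ₗ[k] (S → k) := LinearMap.funLeft k k fun q => ⟨q.1, hST q.2⟩
    have hinj : Function.Injective (ρ.domRestrict ((homPart I d).map (restr T))) := by
      rw [injective_iff_map_eq_zero]
      rintro ⟨_, f, hf, rfl⟩ h0
      rw [Subtype.ext_iff]
      by_contra hne
      obtain ⟨q, hq⟩ := Function.ne_iff.1 hne
      have hq : coeff q.1 f ≠ 0 := hq
      have hf0 : f ≠ 0 := by rintro rfl; simp at hq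
      have hdeg : (m.degree f).degree = d :=
        ((hf.2.degree_eq_sum_deg_support (m.degree_mem_support hf0)).trans rfl).symm
      have hmT := hup q.1 q.2 (m.degree f) hdeg (m.le_degree (mem_support_iff.2 hq))
      have hmS : m.degree f ∈ S := Finset.mem_filter.2 ⟨hmT, f, hf.1, hf0, rfl⟩
      have : coeff (m.degree f) f = 0 := congrFun h0 ⟨_, hmS⟩
      exact hf0 (m.coeff_degree_eq_zero_iff.1 this)
    simpa using LinearMap.finrank_le_finrank_of_injective hinj
  · have h2 : Submodule.span k (Set.range fun q => restr T (F q)) ≤ (homPart I d).map (restr T) := by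
      rw [Submodule.span_le]
      rintro _ ⟨q, rfl⟩
      exact ⟨F q, hFI q, rfl⟩
    have h3 := Submodule.finrank_mono h2
    rw [finrank_span_eq_card hli] at h3
    simpa using h3

end Restriction

/-! ### Openness of linear independence -/

section OpenConditions

/-- Linear independence of a family of vectors is an open condition. -/
theorem exists_ne_zero_imp_linearIndependent {k R s T : Type*} [Field k] [CommRing R] [Algebra k R]
    [Fintype s] [Fintype T] (M : s → T → R) (φ₀ : R →ₐ[k] k)
    (h : LinearIndependent k fun a b => φ₀ (M a b)) :
    ∃ P : R, φ₀ P ≠ 0 ∧ ∀ φ : R →ₐ[k] k, φ P ≠ 0 → LinearIndependent k fun a b => φ (M a b) := by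
  classical
  -- `N` is a right inverse of the matrix `M` specialised at `φ₀`, so `P = det (M N)` takes the
  -- value 1 there. Wherever `P` does not vanish, `M N` is invertible and the rows of `M` are
  -- independent.
  obtain ⟨L, hL⟩ := (Fintype.linearCombination k fun a b => φ₀ (M a b)).exists_leftInverse_of_injective
    (LinearMap.ker_eq_bot.2 (linearIndependent_iff_injective_fintypeLinearCombination.1 h))
  let N : Matrix T s k := fun b a => L (Pi.single b 1) a
  have hL' : ∀ (v : T → k) (a : s), L v a = ∑ b, v b * N b a := by
    intro v a
    conv_lhs => rw [pi_eq_sum_univ' v]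
    simp [N, Finset.sum_apply]
  let P : R := Matrix.det (Matrix.of M * N.map (algebraMap k R))
  have hP : ∀ φ : R →ₐ[k] k, φ P = Matrix.det (Matrix.of (fun a b => φ (M a b)) * N) := by
    intro φ
    rw [AlgHom.map_det]
    congr 1
    ext a b
    simp [Matrix.mul_apply]
  refine ⟨P, ?_, fun φ hφ => ?_⟩
  · have : Matrix.of (fun a b => φ₀ (M a b)) * N = 1 := by
      ext a b
      have := congrFun (LinearMap.congr_fun hL (Pi.single a 1)) b
      rw [LinearMap.comp_apply, hL'] at this
      simpa [Matrix.mul_apply, Fintype.linearCombination_apply_single, Matrix.one_apply,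
        Pi.single_apply, eq_comm] using this
    rw [hP, this, Matrix.det_one]
    exact one_ne_zero
  · rw [hP] at hφ
    have hu : IsUnit (Matrix.of (fun a b => φ (M a b)) * N) :=
      (Matrix.isUnit_iff_isUnit_det _).2 hφ.isUnit
    have hinj := Matrix.vecMul_injective_of_isUnit hu
    have : Function.Injective (Matrix.of (fun a b => φ (M a b))).vecMul := by
      intro v w hvw
      apply hinj
      simp only [← Matrix.vecMul_vecMul]
      exact congrArg (Matrix.vecMul · N) hvw
    exact Matrix.vecMul_injective_iff.1 this

end OpenConditions

/-! ### Linear coordinate changes and semicontinuity of rank -/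

section Coordinates

variable {n : ℕ} {k : Type*} [Field k]

theorem changeCoords_X (g : GL (Fin n) k) (j : Fin n) :
    changeCoords g (X j) = ∑ i, C ((g : Matrix (Fin n) (Fin n) k) i j) * X i :=
  aeval_X _ _

theorem changeCoords_one : changeCoords (1 : GL (Fin n) k) = AlgHom.id k _ := by
  ext j : 1
  rw [changeCoords_X, Finset.sum_eq_single j]
  · simp
  · intro i _ hij
    simp [Matrix.one_apply_ne hij]
  · simp

theorem changeCoords_mul (g h : GL (Fin n) k) :
    changeCoords (g * h) = (changeCoords g).comp (changeCoords h) := by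
  ext j : 1
  rw [AlgHom.comp_apply, changeCoords_X, changeCoords_X, map_sum]
  simp only [map_mul, algHom_C, changeCoords_X, Units.val_mul, Matrix.mul_apply, map_sum,
    Finset.sum_mul, Finset.mul_sum]
  rw [Finset.sum_comm]
  refine Finset.sum_congr rfl fun i _ => Finset.sum_congr rfl fun l _ => ?_
  simp only [algebraMap_eq]
  ring

@[simp]
theorem changeCoords_inv_apply (g : GL (Fin n) k) (f : MvPolynomial (Fin n) k) :
    changeCoords g⁻¹ (changeCoords g f) = f := by
  rw [← AlgHom.comp_apply, ← changeCoords_mul, inv_mul_cancel, changeCoords_one, AlgHom.id_apply]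

@[simp]
theorem changeCoords_apply_inv (g : GL (Fin n) k) (f : MvPolynomial (Fin n) k) :
    changeCoords g (changeCoords g⁻¹ f) = f := by
  rw [← AlgHom.comp_apply, ← changeCoords_mul, mul_inv_cancel, changeCoords_one, AlgHom.id_apply]

theorem mem_map_changeCoords {I : Ideal (MvPolynomial (Fin n) k)} {g : GL (Fin n) k}
    {f : MvPolynomial (Fin n) k} :
    f ∈ I.map (changeCoords g) ↔ changeCoords g⁻¹ f ∈ I := by
  constructor
  · intro h
    have : I.map (changeCoords g) ≤ I.comap (changeCoords g⁻¹) := by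
      rw [Ideal.map_le_iff_le_comap]
      intro x hx
      simpa using hx
    exact this h
  · intro h
    rw [← changeCoords_apply_inv g f]
    exact Ideal.mem_map_of_mem _ h

theorem changeCoords_isHomogeneous (g : GL (Fin n) k) {f : MvPolynomial (Fin n) k} {d : ℕ}
    (hf : f.IsHomogeneous d) : (changeCoords g f).IsHomogeneous d := by
  have := hf.aeval (fun j => ∑ i, C ((g : Matrix (Fin n) (Fin n) k) i j) * X i) (n := 1)
    fun j => IsHomogeneous.sum _ _ _ fun i _ => isHomogeneous_C_mul_X _ _
  rwa [one_mul] at this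

theorem homogeneousComponent_changeCoords (g : GL (Fin n) k) (f : MvPolynomial (Fin n) k) (d : ℕ) :
    homogeneousComponent d (changeCoords g f) = changeCoords g (homogeneousComponent d f) := by
  conv_lhs => rw [← sum_homogeneousComponent f]
  rw [map_sum, map_sum]
  have h : ∀ e, homogeneousComponent d (changeCoords g (homogeneousComponent e f)) =
      if d = e then changeCoords g (homogeneousComponent e f) else 0 := fun e => by
    rw [homogeneousComponent_of_mem
      (changeCoords_isHomogeneous g (homogeneousComponent_isHomogeneous e f))]
  simp only [h]
  rw [Finset.sum_ite_eq]
  split_ifs with hd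
  · rfl
  · rw [homogeneousComponent_eq_zero, map_zero]
    simpa using hd

theorem isHomogeneousIdeal_map_changeCoords {I : Ideal (MvPolynomial (Fin n) k)}
    (hI : IsHomogeneousIdeal I) (g : GL (Fin n) k) :
    IsHomogeneousIdeal (I.map (changeCoords g)) := by
  rw [isHomogeneousIdeal_iff] at hI ⊢
  intro f hf d
  rw [mem_map_changeCoords] at hf ⊢
  rw [← homogeneousComponent_changeCoords]
  exact hI _ hf d

theorem homPart_map_changeCoords (I : Ideal (MvPolynomial (Fin n) k)) (g : GL (Fin n) k) (d : ℕ) :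
    homPart (I.map (changeCoords g)) d = (homPart I d).map (changeCoords g).toLinearMap := by
  ext f
  simp only [Submodule.mem_map, mem_homPart, mem_map_changeCoords]
  constructor
  · rintro ⟨h1, h2⟩
    exact ⟨_, ⟨h1, changeCoords_isHomogeneous _ h2⟩, changeCoords_apply_inv g f⟩
  · rintro ⟨f, ⟨h1, h2⟩, rfl⟩
    exact ⟨by simpa using h1, changeCoords_isHomogeneous _ h2⟩

/-- The entries of an invertible matrix, as a point of affine space. -/
def entries (g : GL (Fin n) k) : Fin n × Fin n → k :=
  fun p => (g : Matrix (Fin n) (Fin n) k) p.1 p.2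

/-- The linear change of coordinates with indeterminate coefficients. -/
def genericCoords (n : ℕ) (k : Type*) [Field k] : MvPolynomial (Fin n) k →ₐ[k]
    MvPolynomial (Fin n) (MvPolynomial (Fin n × Fin n) k) :=
  aeval fun j => ∑ i, C (X (i, j)) * X i

theorem map_genericCoords (g : GL (Fin n) k) (f : MvPolynomial (Fin n) k) :
    mapAlgHom (aeval (entries g)) (genericCoords n k f) = changeCoords g f := by
  have : (mapAlgHom (aeval (entries g))).comp (genericCoords n k) = changeCoords g := by
    ext j : 1
    rw [AlgHom.comp_apply, changeCoords_X, genericCoords, aeval_X]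
    simp [entries]
  rw [← this, AlgHom.comp_apply]

/-- Makes every coefficient of `g(f)` a polynomial in the entries of `g`, so that rank conditions on
`g` become nonvanishing of polynomials. -/
theorem coeff_changeCoords (g : GL (Fin n) k) (f : MvPolynomial (Fin n) k) (q : Fin n →₀ ℕ) :
    coeff q (changeCoords g f) = aeval (entries g) (coeff q (genericCoords n k f)) := by
  rw [← map_genericCoords, mapAlgHom_apply, coeff_map]
  rfl

/-- The rank of the projection of `g(W)` to finitely many coordinates is lower semicontinuous
in `g`. -/
theorem exists_polynomial_finrank_le (W : Submodule k (MvPolynomial (Fin n) k))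
    (T : Finset (Fin n →₀ ℕ)) (g₀ : GL (Fin n) k) :
    ∃ P : MvPolynomial (Fin n × Fin n) k, aeval (entries g₀) P ≠ 0 ∧
      ∀ g : GL (Fin n) k, aeval (entries g) P ≠ 0 →
        Module.finrank k ((W.map (changeCoords g₀).toLinearMap).map (restr T)) ≤
          Module.finrank k ((W.map (changeCoords g).toLinearMap).map (restr T)) := by
  let b := Module.finBasis k ((W.map (changeCoords g₀).toLinearMap).map (restr T))
  have hf : ∀ a, ∃ f ∈ W, restr T (changeCoords g₀ f) = (b a : T → k) := by
    intro a
    obtain ⟨_, ⟨f, hf, rfl⟩, h⟩ := (b a).2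
    exact ⟨f, hf, h⟩
  choose f hfW hf using hf
  have hli : LinearIndependent k fun a (q : T) =>
      aeval (entries g₀) (coeff q.1 (genericCoords n k (f a))) := by
    have e : (fun a (q : T) => aeval (entries g₀) (coeff q.1 (genericCoords n k (f a)))) =
        Submodule.subtype _ ∘ b := by
      ext a q
      rw [← coeff_changeCoords, Function.comp_apply, Submodule.subtype_apply, ← hf, restr_apply]
    rw [e]
    exact b.linearIndependent.map' (Submodule.subtype _) (Submodule.ker_subtype _)
  obtain ⟨P, hP, h⟩ := exists_ne_zero_imp_linearIndependent
    (fun a (q : T) => coeff q.1 (genericCoords n k (f a))) (aeval (entries g₀)) hli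
  refine ⟨P, hP, fun g hg => ?_⟩
  have h1 := finrank_span_eq_card (h _ hg)
  rw [Fintype.card_fin] at h1
  rw [← h1]
  apply Submodule.finrank_mono
  rw [Submodule.span_le]
  rintro _ ⟨a, rfl⟩
  refine ⟨_, ⟨f a, hfW a, rfl⟩, ?_⟩
  ext q
  exact coeff_changeCoords _ _ _

end Coordinates

/-! ### Generic coordinates: maximal ranks and a neighbourhood of the identity -/

section GenericCoordinates

variable {n : ℕ} {k : Type*} [Field k]

theorem exists_aeval_entries_ne_zero [Infinite k] {P : MvPolynomial (Fin n × Fin n) k}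
    (hP : P ≠ 0) : ∃ g : GL (Fin n) k, aeval (entries g) P ≠ 0 := by
  have hdet := Matrix.det_mvPolynomialX_ne_zero (Fin n) k
  by_contra! h
  refine mul_ne_zero hP hdet (MvPolynomial.funext fun x => ?_)
  rw [map_mul, map_zero, Matrix.eval_det_mvPolynomialX]
  by_cases hx : Matrix.det (Matrix.of fun i j => x (i, j)) = 0
  · exact mul_eq_zero_of_right _ hx
  · refine mul_eq_zero_of_left (Eq.trans ?_ (h (Matrix.GeneralLinearGroup.mkOfDetNeZero _ hx))) _
    rw [aeval_eq_eval]
    rfl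

/-- The exponents of degree `d`. -/
def degExps (n d : ℕ) : Finset (Fin n →₀ ℕ) := Finset.univ.finsuppAntidiag d

@[simp]
theorem mem_degExps {d : ℕ} {q : Fin n →₀ ℕ} : q ∈ degExps n d ↔ q.degree = d := by
  simp [degExps, Finset.mem_finsuppAntidiag, Finsupp.degree_eq_sum]

/-- A set of exponents of degree `d` that contains with an exponent all greater ones. -/
def IsUpperExps (m : MonomialOrder (Fin n)) (d : ℕ) (T : Finset (Fin n →₀ ℕ)) : Prop :=
  (∀ q ∈ T, q.degree = d) ∧
    ∀ q ∈ T, ∀ q' : Fin n →₀ ℕ, q'.degree = d → q ≼[m] q' → q' ∈ T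

theorem isUpperExps_degExps (m : MonomialOrder (Fin n)) (d : ℕ) :
    IsUpperExps m d (degExps n d) :=
  ⟨fun _ h => mem_degExps.1 h, fun _ _ _ h _ => mem_degExps.2 h⟩

theorem isUpperExps_filter_le (m : MonomialOrder (Fin n)) (d : ℕ) (c : Fin n →₀ ℕ) :
    IsUpperExps m d ((degExps n d).filter (c ≼[m] ·)) := by
  refine ⟨fun q h => mem_degExps.1 (Finset.mem_filter.1 h).1, fun q h q' hq' hqq' => ?_⟩
  exact Finset.mem_filter.2 ⟨mem_degExps.2 hq', (Finset.mem_filter.1 h).2.trans hqq'⟩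

theorem isUpperExps_filter_lt (m : MonomialOrder (Fin n)) (d : ℕ) (c : Fin n →₀ ℕ) :
    IsUpperExps m d ((degExps n d).filter (c ≺[m] ·)) := by
  refine ⟨fun q h => mem_degExps.1 (Finset.mem_filter.1 h).1, fun q h q' hq' hqq' => ?_⟩
  exact Finset.mem_filter.2 ⟨mem_degExps.2 hq', (Finset.mem_filter.1 h).2.trans_le hqq'⟩

variable {I : Ideal (MvPolynomial (Fin n) k)}

open Classical in
/-- In generic coordinates the number of leading exponents in an upper set is maximal. -/
theorem finrank_map_changeCoords_le [Infinite k] (hI : IsHomogeneousIdeal I)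
    (hgen : InGenericCoordinates I) {d : ℕ} {T : Finset (Fin n →₀ ℕ)}
    (hT : IsUpperExps MonomialOrder.degLex d T) (g : GL (Fin n) k) :
    Module.finrank k (((homPart I d).map (changeCoords g).toLinearMap).map (restr T)) ≤
      (T.filter (· ∈ leadExps MonomialOrder.degLex I)).card := by
  obtain ⟨U, ⟨J, rfl⟩, ⟨g₁, hg₁⟩, hU⟩ := hgen
  have hg₁' : ¬ ∀ p ∈ J, aeval (entries g₁) p = 0 := hg₁
  push Not at hg₁'
  obtain ⟨Q, hQJ, hQ⟩ := hg₁'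
  obtain ⟨P, hP, hle⟩ := exists_polynomial_finrank_le (homPart I d) T g
  -- Irreducibility of `GL_n`: the open sets `P ≠ 0` and `Q ≠ 0` are nonempty, so they share a point
  -- `h`. There the rank is at least that at `g`, and `h(I)` has the initial ideal of `I`.
  have hPQ : P * Q ≠ 0 := by
    refine mul_ne_zero ?_ ?_ <;> rintro rfl
    · simp at hP
    · simp at hQ
  obtain ⟨h, hh⟩ := exists_aeval_entries_ne_zero hPQ
  rw [map_mul] at hh
  refine (hle h (left_ne_zero_of_mul hh)).trans ?_
  have hL := initialIdeal_eq_iff.1 (hU h fun h0 =>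
    right_ne_zero_of_mul hh ((mem_zeroLocus_iff.1 h0) Q hQJ))
  rw [← homPart_map_changeCoords,
    finrank_map_restr (isHomogeneousIdeal_map_changeCoords hI h) hT.1 hT.2, hL]

open Classical in
theorem card_leadExps_map_changeCoords_le [Infinite k] (hI : IsHomogeneousIdeal I)
    (hgen : InGenericCoordinates I) {d : ℕ} {T : Finset (Fin n →₀ ℕ)}
    (hT : IsUpperExps MonomialOrder.degLex d T) (g : GL (Fin n) k) :
    (T.filter (· ∈ leadExps MonomialOrder.degLex (I.map (changeCoords g)))).card ≤
      (T.filter (· ∈ leadExps MonomialOrder.degLex I)).card := by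
  rw [← finrank_map_restr (isHomogeneousIdeal_map_changeCoords hI g) hT.1 hT.2,
    homPart_map_changeCoords]
  exact finrank_map_changeCoords_le hI hgen hT g

/-- Near the identity ranks cannot drop, and generic coordinates forbid them to rise, so the counts
on all upper sets of degree `d` agree. These counts determine the leading exponents. -/
theorem exists_polynomial_leadExps_degree [Infinite k] (hI : IsHomogeneousIdeal I)
    (hgen : InGenericCoordinates I) (d : ℕ) :
    ∃ P : MvPolynomial (Fin n × Fin n) k, aeval (entries (1 : GL (Fin n) k)) P ≠ 0 ∧
      ∀ g : GL (Fin n) k, aeval (entries g) P ≠ 0 → ∀ q : Fin n →₀ ℕ, q.degree = d →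
        (q ∈ leadExps MonomialOrder.degLex (I.map (changeCoords g)) ↔
          q ∈ leadExps MonomialOrder.degLex I) := by
  classical
  choose P hP1 hP using fun T => exists_polynomial_finrank_le (homPart I d) T (1 : GL (Fin n) k)
  refine ⟨∏ T ∈ (degExps n d).powerset, P T, ?_, fun g hg q hq => ?_⟩
  · rw [map_prod]
    exact Finset.prod_ne_zero_iff.2 fun T _ => hP1 T
  rw [map_prod, Finset.prod_ne_zero_iff] at hg
  have hcard : ∀ T, IsUpperExps MonomialOrder.degLex d T →
      (T.filter (· ∈ leadExps MonomialOrder.degLex (I.map (changeCoords g)))).card =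
      (T.filter (· ∈ leadExps MonomialOrder.degLex I)).card := by
    intro T hT
    refine le_antisymm (card_leadExps_map_changeCoords_le hI hgen hT g) ?_
    rw [← finrank_map_restr (isHomogeneousIdeal_map_changeCoords hI g) hT.1 hT.2,
      ← finrank_map_restr hI hT.1 hT.2]
    have := hP T g (hg T (Finset.mem_powerset.2 fun q h => mem_degExps.2 (hT.1 q h)))
    rwa [changeCoords_one, AlgHom.toLinearMap_id, Submodule.map_id,
      ← homPart_map_changeCoords] at this
  have h1 := hcard _ (isUpperExps_filter_le MonomialOrder.degLex d q)
  have h2 := hcard _ (isUpperExps_filter_lt MonomialOrder.degLex d q)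
  -- The upper sets "at least `q`" and "greater than `q`" differ by `q` alone, so the two equal
  -- counts decide whether `q` is a leading exponent.
  have hins : (degExps n d).filter (q ≼[MonomialOrder.degLex] ·) =
      insert q ((degExps n d).filter (q ≺[MonomialOrder.degLex] ·)) := by
    ext s
    simp only [Finset.mem_filter, Finset.mem_insert, mem_degExps, le_iff_eq_or_lt,
      EmbeddingLike.apply_eq_iff_eq]
    constructor
    · rintro ⟨hs, h | h⟩
      · exact Or.inl h.symm
      · exact Or.inr ⟨hs, h⟩
    · rintro (rfl | ⟨hs, h⟩)
      · exact ⟨hq, Or.inl rfl⟩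
      · exact ⟨hs, Or.inr h⟩
  have hq' : ∀ L : Set (Fin n →₀ ℕ),
      q ∉ ((degExps n d).filter (q ≺[MonomialOrder.degLex] ·)).filter (· ∈ L) := by
    intro L h
    simp at h
  rw [hins, Finset.filter_insert, Finset.filter_insert] at h1
  split_ifs at h1 with ha hb hb
  · exact iff_of_true ha hb
  · rw [Finset.card_insert_of_notMem (hq' _)] at h1
    omega
  · rw [Finset.card_insert_of_notMem (hq' _)] at h1
    omega
  · exact iff_of_false ha hb

/-- If `I` is in generic coordinates, then its initial ideal does not change under the coordinate
changes in a Zariski neighbourhood of the identity. -/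
theorem exists_polynomial_leadExps [Infinite k] (hI : IsHomogeneousIdeal I)
    (hgen : InGenericCoordinates I) :
    ∃ P : MvPolynomial (Fin n × Fin n) k, aeval (entries (1 : GL (Fin n) k)) P ≠ 0 ∧
      ∀ g : GL (Fin n) k, aeval (entries g) P ≠ 0 →
        leadExps MonomialOrder.degLex (I.map (changeCoords g)) =
          leadExps MonomialOrder.degLex I := by
  classical
  obtain ⟨S, hSL, hS⟩ := exists_finset_leadExps MonomialOrder.degLex I
  choose P hP1 hP using exists_polynomial_leadExps_degree hI hgen
  refine ⟨∏ s ∈ S, P s.degree, ?_, fun g hg => ?_⟩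
  · rw [map_prod]
    exact Finset.prod_ne_zero_iff.2 fun s _ => hP1 _
  rw [map_prod, Finset.prod_ne_zero_iff] at hg
  -- Only the degrees of finitely many generating exponents are controlled by `P`. They give this
  -- inclusion in all degrees, and the maximality of the count then forces equality.
  have hsub : leadExps MonomialOrder.degLex I ⊆
      leadExps MonomialOrder.degLex (I.map (changeCoords g)) := by
    intro q hq
    obtain ⟨s, hs, hsq⟩ := hS q hq
    exact mem_leadExps_of_le ((hP _ g (hg s hs) s rfl).2 (hSL hs)) hsq
  refine Set.Subset.antisymm (fun q hq => ?_) hsub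
  have hcard := card_leadExps_map_changeCoords_le hI hgen
    (isUpperExps_degExps MonomialOrder.degLex q.degree) g
  have heq := Finset.eq_of_subset_of_card_le
    (Finset.monotone_filter_right (degExps n q.degree) fun s _ hs => hsub hs) hcard
  have : q ∈ (degExps n q.degree).filter
      (· ∈ leadExps MonomialOrder.degLex (I.map (changeCoords g))) :=
    Finset.mem_filter.2 ⟨mem_degExps.2 rfl, hq⟩
  rw [← heq] at this
  exact (Finset.mem_filter.1 this).2

end GenericCoordinates

/-! ### Strong stability of the initial ideal in characteristic zero -/

section Exchange

variable {n : ℕ} {k : Type*} [Field k]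

/-- The coordinate change `x_j ↦ x_j + t x_i`. -/
def shear {i j : Fin n} (hij : i ≠ j) (t : k) : GL (Fin n) k :=
  Matrix.GeneralLinearGroup.mkOfDetNeZero (Matrix.transvection i j t)
    (by rw [Matrix.det_transvection_of_ne i j hij]; exact one_ne_zero)

theorem changeCoords_shear_X {i j : Fin n} (hij : i ≠ j) (t : k) (l : Fin n) :
    changeCoords (shear hij t) (X l) = X l + if l = j then C t * X i else 0 := by
  have h : ∀ a, ((shear hij t : GL (Fin n) k) : Matrix (Fin n) (Fin n) k) a l =
      (if a = l then 1 else 0) + if l = j then (if a = i then t else 0) else 0 := by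
    intro a
    change Matrix.transvection i j t a l = _
    rw [Matrix.transvection, Matrix.add_apply, Matrix.one_apply, Matrix.single_apply]
    congr 1
    by_cases h1 : a = i <;> by_cases h2 : l = j <;> simp [h1, h2, @eq_comm _ i a, @eq_comm _ j l]
  rw [changeCoords_X]
  simp only [h, C_add, add_mul, Finset.sum_add_distrib]
  congr 1
  · rw [Finset.sum_eq_single l] <;> simp +contextual
  · split_ifs
    · rw [Finset.sum_eq_single i] <;> simp +contextual
    · simp

/-- The coordinate change `x_j ↦ x_j + t x_i` with an indeterminate `t`. -/
def shearPoly (k : Type*) [Field k] (i j : Fin n) :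
    MvPolynomial (Fin n) k →ₐ[k] Polynomial (MvPolynomial (Fin n) k) :=
  aeval fun l => Polynomial.C (X l) + if l = j then Polynomial.C (X i) * Polynomial.X else 0

theorem shearPoly_X (i j l : Fin n) : shearPoly k i j (X l) =
    Polynomial.C (X l) + if l = j then Polynomial.C (X i) * Polynomial.X else 0 :=
  aeval_X _ _

theorem shearPoly_C (i j : Fin n) (c : k) : shearPoly k i j (C c) = Polynomial.C (C c) :=
  aeval_C _ _

theorem eval_shearPoly {i j : Fin n} (hij : i ≠ j) (t : k) (f : MvPolynomial (Fin n) k) :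
    (shearPoly k i j f).eval (C t) = changeCoords (shear hij t) f := by
  induction f using MvPolynomial.induction_on with
  | C c => rw [shearPoly_C, Polynomial.eval_C, algHom_C, algebraMap_eq]
  | add f g hf hg => rw [map_add, map_add, Polynomial.eval_add, hf, hg]
  | mul_X f l hf =>
    rw [map_mul, map_mul, Polynomial.eval_mul, hf, shearPoly_X, changeCoords_shear_X]
    rw [mul_comm (C t)]
    split_ifs <;> simp

theorem coeff_zero_shearPoly (i j : Fin n) (f : MvPolynomial (Fin n) k) :
    (shearPoly k i j f).coeff 0 = f := by
  induction f using MvPolynomial.induction_on with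
  | C c => rw [shearPoly_C, Polynomial.coeff_C_zero]
  | add f g hf hg => rw [map_add, Polynomial.coeff_add, hf, hg]
  | mul_X f l hf =>
    rw [map_mul, Polynomial.mul_coeff_zero, hf, shearPoly_X]
    split_ifs <;> simp

/-- The first-order term of the shear is the derivation `x_i ∂/∂x_j`, which exchanges one factor
`x_j` for `x_i`. -/
theorem coeff_one_shearPoly (i j : Fin n) (f : MvPolynomial (Fin n) k) :
    (shearPoly k i j f).coeff 1 = X i * pderiv j f := by
  induction f using MvPolynomial.induction_on with
  | C c => rw [shearPoly_C, Polynomial.coeff_C_of_ne_zero one_ne_zero, pderiv_C, mul_zero]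
  | add f g hf hg => rw [map_add, Polynomial.coeff_add, hf, hg, map_add, mul_add]
  | mul_X f l hf =>
    rw [map_mul, Polynomial.mul_coeff_one, hf, coeff_zero_shearPoly, shearPoly_X, pderiv_mul]
    split_ifs with h
    · subst h
      simp
      ring
    · rw [pderiv_X_of_ne h]
      simp
      ring

/-- The coefficient at `q` of a polynomial in `t` with coefficients in a polynomial ring. -/
def coeffPoly (q : Fin n →₀ ℕ) (F : Polynomial (MvPolynomial (Fin n) k)) : Polynomial k :=
  ∑ e ∈ Finset.range (F.natDegree + 1), Polynomial.monomial e (coeff q (F.coeff e))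

theorem eval_coeffPoly (q : Fin n →₀ ℕ) (F : Polynomial (MvPolynomial (Fin n) k)) (t : k) :
    (coeffPoly q F).eval t = coeff q (F.eval (C t)) := by
  rw [coeffPoly, Polynomial.eval_finsetSum, Polynomial.eval_eq_sum_range, coeff_sum]
  refine Finset.sum_congr rfl fun e _ => ?_
  rw [Polynomial.eval_monomial, ← C_pow, mul_comm (F.coeff e), coeff_C_mul, mul_comm]

theorem coeff_X_mul_pderiv (i j : Fin n) (u : Fin n →₀ ℕ) (f : MvPolynomial (Fin n) k) :
    coeff (u + Finsupp.single i 1) (X i * pderiv j f) =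
      coeff (u + Finsupp.single j 1) f * (u j + 1) := by
  rw [add_comm u, coeff_X_mul, coeff_pderiv]

/-- Every monomial has one `x_j` replaced by `x_i`, which preserves their order; the leading one
survives because its factor `u j + 1` is nonzero in characteristic zero. -/
theorem degree_X_mul_pderiv {m : MonomialOrder (Fin n)} [CharZero k] {i j : Fin n}
    {u : Fin n →₀ ℕ} {f : MvPolynomial (Fin n) k} (hf0 : f ≠ 0)
    (hf : m.degree f = u + Finsupp.single j 1) :
    X i * pderiv j f ≠ 0 ∧ m.degree (X i * pderiv j f) = u + Finsupp.single i 1 := by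
  have hc : coeff (u + Finsupp.single i 1) (X i * pderiv j f) ≠ 0 := by
    rw [coeff_X_mul_pderiv, ← hf]
    exact mul_ne_zero (m.coeff_degree_ne_zero_iff.2 hf0) (Nat.cast_add_one_ne_zero _)
  refine ⟨fun h => hc (by rw [h, coeff_zero]), m.toSyn.injective (le_antisymm ?_
    (m.le_degree (mem_support_iff.2 hc)))⟩
  rw [m.degree_le_iff]
  intro r hr
  have hri : Finsupp.single i 1 ≤ r := by
    classical
    rw [support_X_mul, Finset.mem_map] at hr
    obtain ⟨v, -, rfl⟩ := hr
    exact le_self_add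
  obtain ⟨v, rfl⟩ := exists_add_of_le hri
  rw [mem_support_iff, add_comm, coeff_X_mul_pderiv] at hr
  have hle := m.le_degree (mem_support_iff.2 (left_ne_zero_of_mul hr))
  rw [hf, map_add, map_add, add_le_add_iff_right] at hle
  rw [add_comm, map_add, map_add]
  exact add_le_add_left hle _

/-- The initial ideal of an ideal in generic coordinates is strongly stable. -/
theorem add_single_mem_leadExps [CharZero k] {I : Ideal (MvPolynomial (Fin n) k)}
    (hI : IsHomogeneousIdeal I) (hgen : InGenericCoordinates I) {i j : Fin n} (hij : i < j)
    {u : Fin n →₀ ℕ} (hu : u + Finsupp.single j 1 ∈ leadExps MonomialOrder.degLex I) :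
    u + Finsupp.single i 1 ∈ leadExps MonomialOrder.degLex I := by
  classical
  by_contra hnot
  obtain ⟨f, hf, hfd, hf0, hfu⟩ := exists_isHomogeneous_of_mem_leadExps hI hu
  set p := u + Finsupp.single i 1 with hp
  set d := (u + Finsupp.single j 1).degree with hd
  have hpd : p.degree = d := by simp [hp, hd]
  have hlt : u + Finsupp.single j 1 ≺[MonomialOrder.degLex] p := by
    rw [map_add, hp, map_add]
    exact add_lt_add_right (MonomialOrder.degLex_single_lt_iff.2 hij) _
  set T := (degExps n d).filter (p ≼[MonomialOrder.degLex] ·) with hTdef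
  have hT : IsUpperExps MonomialOrder.degLex d T := isUpperExps_filter_le _ _ _
  have hpT : p ∈ T := Finset.mem_filter.2 ⟨mem_degExps.2 hpd, le_rfl⟩
  set S := T.filter (· ∈ leadExps MonomialOrder.degLex I) with hS
  have hpS : p ∉ S := fun h => hnot (Finset.mem_filter.1 h).2
  -- If `p` were not a leading exponent, the sheared ideal would acquire rank `S.card + 1` on `T`,
  -- above the maximum. The independent vectors are deformations in `t`, whose values at `t = 0`
  -- have the distinct leading exponents in `insert p S`.
  have hF : ∀ q : (insert p S : Finset (Fin n →₀ ℕ)),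
      ∃ F : Polynomial (MvPolynomial (Fin n) k),
        F.eval 0 ≠ 0 ∧ MonomialOrder.degLex.degree (F.eval 0) = q.1 ∧
        ∀ t : k, t ≠ 0 → restr T (F.eval (C t)) ∈
          ((homPart I d).map (changeCoords (shear hij.ne t)).toLinearMap).map (restr T) := by
    rintro ⟨q, hq⟩
    rcases Finset.mem_insert.1 hq with rfl | hq
    -- All exponents of `f` lie below `p`, so `f` vanishes on `T`. There the sheared `f` is
    -- divisible by `t`, and the quotient tends to `x_i ∂f/∂x_j`, with leading exponent `p`.
    · refine ⟨(shearPoly k i j f).divX, ?_⟩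
      rw [← Polynomial.coeff_zero_eq_eval_zero, Polynomial.coeff_divX, coeff_one_shearPoly]
      refine ⟨(degree_X_mul_pderiv hf0 hfu).1, (degree_X_mul_pderiv hf0 hfu).2, fun t ht => ?_⟩
      have h1 : restr T (changeCoords (shear hij.ne t) f) =
          t • restr T ((shearPoly k i j f).divX.eval (C t)) := by
        rw [← eval_shearPoly, ← map_smul]
        conv_lhs => rw [← Polynomial.divX_mul_X_add (shearPoly k i j f)]
        ext q
        have hq0 : coeff q.1 f = 0 := by
          refine MonomialOrder.degLex.coeff_eq_zero_of_lt ?_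
          rw [hfu]
          exact hlt.trans_le (Finset.mem_filter.1 q.2).2
        simp [coeff_zero_shearPoly, hq0, mul_comm]
      rw [← inv_smul_smul₀ ht (restr T _), ← h1]
      exact Submodule.smul_mem _ _ ⟨_, ⟨f, ⟨hf, hfd⟩, rfl⟩, rfl⟩
    · obtain ⟨hqT, hqL⟩ := Finset.mem_filter.1 hq
      obtain ⟨h, hh, hhd, hh0, hhq⟩ := exists_isHomogeneous_of_mem_leadExps hI hqL
      refine ⟨shearPoly k i j h, ?_⟩
      rw [← Polynomial.coeff_zero_eq_eval_zero, coeff_zero_shearPoly]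
      refine ⟨hh0, hhq, fun t _ => ?_⟩
      rw [eval_shearPoly hij.ne]
      exact ⟨_, ⟨h, ⟨hh, hT.1 q hqT ▸ hhd⟩, rfl⟩, rfl⟩
  choose F hF0 hFq hFmem using hF
  have hli : LinearIndependent k fun a (b : T) =>
      Polynomial.aeval (0 : k) (coeffPoly b.1 (F a)) := by
    have := linearIndependent_restr_of_degree (m := MonomialOrder.degLex) _ hF0 hFq
      (Finset.insert_subset hpT (Finset.filter_subset _ _))
    have e : (fun a (b : T) => Polynomial.aeval (0 : k) (coeffPoly b.1 (F a))) =
        fun a => restr T ((F a).eval 0) := by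
      ext a b
      rw [Polynomial.coe_aeval_eq_eval, eval_coeffPoly, C_0, restr_apply]
    rwa [e]
  obtain ⟨P, hP0, hP⟩ := exists_ne_zero_imp_linearIndependent
    (fun a (b : T) => coeffPoly b.1 (F a)) (Polynomial.aeval (0 : k)) hli
  -- The factor `X` forces `t ≠ 0`, needed to undo the division by `t`.
  have hXP : Polynomial.X * P ≠ 0 :=
    mul_ne_zero Polynomial.X_ne_zero (by rintro rfl; simp at hP0)
  obtain ⟨t, ht⟩ : ∃ t, (Polynomial.X * P).eval t ≠ 0 := by
    by_contra! h
    exact hXP (Polynomial.funext fun t => by rw [h, Polynomial.eval_zero])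
  rw [Polynomial.eval_mul, Polynomial.eval_X] at ht
  have h1 := finrank_span_eq_card (hP (Polynomial.aeval t) (right_ne_zero_of_mul ht))
  rw [Fintype.card_coe, Finset.card_insert_of_notMem hpS] at h1
  have h2 : Submodule.span k (Set.range fun a (b : T) =>
      Polynomial.aeval t (coeffPoly b.1 (F a))) ≤
        ((homPart I d).map (changeCoords (shear hij.ne t)).toLinearMap).map (restr T) := by
    rw [Submodule.span_le]
    rintro _ ⟨a, rfl⟩
    have e : (fun b : T => Polynomial.aeval t (coeffPoly b.1 (F a))) =
        restr T ((F a).eval (C t)) := by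
      ext b
      rw [Polynomial.coe_aeval_eq_eval, eval_coeffPoly, restr_apply]
    have hmem := hFmem a t (left_ne_zero_of_mul ht)
    rw [← e] at hmem
    exact hmem
  have h3 := (Submodule.finrank_mono h2).trans
    (finrank_map_changeCoords_le hI hgen hT (shear hij.ne t))
  rw [h1] at h3
  exact absurd h3 (by rw [← hS]; omega)

end Exchange

/-! ### GLex and the exponent of `x_0` -/

section DegLexCons

variable {r : ℕ}

theorem degree_cons (i : ℕ) (s : Fin r →₀ ℕ) : (Finsupp.cons i s).degree = i + s.degree := by
  simp [Finsupp.degree_eq_sum, Fin.sum_univ_succ]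

theorem zero_le_zero_of_degLex_le {q s : Fin (r + 1) →₀ ℕ} (hd : q.degree = s.degree)
    (h : q ≼[MonomialOrder.degLex] s) : q 0 ≤ s 0 := by
  rcases h.eq_or_lt with h | h
  · rw [MonomialOrder.degLex.toSyn.injective h]
  rw [MonomialOrder.degLex_lt_iff, Finsupp.DegLex.lt_iff] at h
  rcases h with h | ⟨-, h⟩
  · exact absurd hd h.ne
  · obtain ⟨j, hj, hlt⟩ := Finsupp.Lex.lt_iff.1 h
    rcases Fin.eq_zero_or_eq_succ j with rfl | ⟨j, rfl⟩
    · exact hlt.le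
    · exact (hj 0 (Fin.succ_pos j)).le

theorem cons_degLex_lt_cons (i : ℕ) {a b : Fin r →₀ ℕ} (h : a ≺[MonomialOrder.degLex] b) :
    Finsupp.cons i a ≺[MonomialOrder.degLex] Finsupp.cons i b := by
  rw [MonomialOrder.degLex_lt_iff, Finsupp.DegLex.lt_iff] at h ⊢
  simp only [ofDegLex_toDegLex, degree_cons] at h ⊢
  rcases h with h | ⟨hd, h⟩
  · exact Or.inl (by omega)
  · refine Or.inr ⟨by omega, ?_⟩
    obtain ⟨j, hj, hlt⟩ := Finsupp.Lex.lt_iff.1 h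
    refine Finsupp.Lex.lt_iff.2 ⟨j.succ, fun l hl => ?_, by simpa using hlt⟩
    rcases Fin.eq_zero_or_eq_succ l with rfl | ⟨l, rfl⟩
    · simp
    · simpa using hj l (Fin.succ_lt_succ_iff.1 hl)

end DegLexCons

/-! ### Leading exponents of partial elimination ideals -/

section PartialEliminationIdeals

variable {r : ℕ} {k : Type*} [Field k] {I : Ideal (MvPolynomial (Fin (r + 1)) k)}

@[simp]
theorem coeff_bar (i : ℕ) (f : MvPolynomial (Fin (r + 1)) k) (s : Fin r →₀ ℕ) :
    coeff s (bar i f) = coeff (s.cons i) f :=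
  finSuccEquiv_coeff_coeff _ _ _

theorem homogeneousComponent_bar (i e : ℕ) (f : MvPolynomial (Fin (r + 1)) k) :
    homogeneousComponent e (bar i f) = bar i (homogeneousComponent (i + e) f) := by
  ext s
  simp [coeff_homogeneousComponent, degree_cons]

theorem d0_le_iff {f : MvPolynomial (Fin (r + 1)) k} {d : ℕ} (hf : f.IsHomogeneous d) {i : ℕ} :
    d0 f ≤ i ↔ degreeOf 0 f ≤ i := by
  rw [degreeOf_le_iff]
  by_cases hf0 : f = 0
  · simp [hf0, d0]
  have hmem := MonomialOrder.degLex.degree_mem_support hf0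
  constructor
  · intro h q hq
    refine (zero_le_zero_of_degLex_le ?_ (MonomialOrder.degLex.le_degree hq)).trans h
    exact (hf.degree_eq_sum_deg_support hq).symm.trans (hf.degree_eq_sum_deg_support hmem)
  · exact fun h => h _ hmem

theorem d0_eq_degreeOf {f : MvPolynomial (Fin (r + 1)) k} {d : ℕ} (hf : f.IsHomogeneous d) :
    d0 f = degreeOf 0 f :=
  le_antisymm ((d0_le_iff hf).2 le_rfl) ((d0_le_iff hf).1 le_rfl)

theorem degreeOf_add_le_of_le {f g : MvPolynomial (Fin (r + 1)) k} {i : ℕ} (hf : degreeOf 0 f ≤ i)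
    (hg : degreeOf 0 g ≤ i) : degreeOf 0 (f + g) ≤ i :=
  (degreeOf_add_le _ _ _).trans (max_le hf hg)

/-- For homogeneous polynomials `d0` is the degree in `x_0`. Unlike `d0`, a bound on that degree
passes to homogeneous components, so the span can be described without sums. -/
theorem mem_Ktilde_iff (hI : IsHomogeneousIdeal I) {i : ℕ} {f : MvPolynomial (Fin (r + 1)) k} :
    f ∈ Ktilde i I ↔ f ∈ I ∧ degreeOf 0 f ≤ i := by
  constructor
  · intro hf
    induction hf using Submodule.span_induction with
    | mem f hf =>
      obtain ⟨hfI, ⟨d, hd⟩, hi⟩ := hf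
      exact ⟨hfI, (d0_le_iff hd).1 hi⟩
    | zero => simp
    | add f g _ _ hf hg => exact ⟨add_mem hf.1 hg.1, degreeOf_add_le_of_le hf.2 hg.2⟩
    | smul c f _ hf =>
      rw [smul_eq_C_mul]
      exact ⟨I.mul_mem_left _ hf.1, (degreeOf_C_mul_le _ _ _).trans hf.2⟩
  · rintro ⟨hf, hi⟩
    rw [← sum_homogeneousComponent f]
    refine Submodule.sum_mem _ fun d _ => Submodule.subset_span ⟨isHomogeneousIdeal_iff.1 hI f hf d,
      ⟨d, homogeneousComponent_isHomogeneous d f⟩, ?_⟩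
    rw [d0_le_iff (homogeneousComponent_isHomogeneous d f), degreeOf_le_iff]
    rw [degreeOf_le_iff] at hi
    intro q hq
    rw [support_homogeneousComponent] at hq
    exact hi q (Finset.mem_filter.1 hq).1

theorem mem_partialEliminationIdeal_iff (hI : IsHomogeneousIdeal I) {i : ℕ}
    {q : MvPolynomial (Fin r) k} :
    q ∈ partialEliminationIdeal i I ↔ ∃ f ∈ I, degreeOf 0 f ≤ i ∧ bar i f = q := by
  change (∃ f ∈ Ktilde i I, bar i f = q) ↔ _
  simp only [mem_Ktilde_iff hI, and_assoc]

theorem exists_homogeneousComponent_eq_bar (hI : IsHomogeneousIdeal I) {i e : ℕ}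
    {q : MvPolynomial (Fin r) k} (hq : q ∈ partialEliminationIdeal i I) :
    ∃ f ∈ I, f.IsHomogeneous (i + e) ∧ degreeOf 0 f ≤ i ∧ bar i f = homogeneousComponent e q := by
  obtain ⟨f, hf, hi, rfl⟩ := (mem_partialEliminationIdeal_iff hI).1 hq
  refine ⟨_, isHomogeneousIdeal_iff.1 hI f hf (i + e), homogeneousComponent_isHomogeneous _ _, ?_,
    (homogeneousComponent_bar i e f).symm⟩
  rw [degreeOf_le_iff] at hi ⊢
  intro s hs
  rw [support_homogeneousComponent] at hs
  exact hi s (Finset.mem_filter.1 hs).1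

theorem isHomogeneousIdeal_partialEliminationIdeal (hI : IsHomogeneousIdeal I) (i : ℕ) :
    IsHomogeneousIdeal (partialEliminationIdeal i I) := by
  rw [isHomogeneousIdeal_iff]
  intro q hq e
  obtain ⟨f, hf, -, hi, h⟩ := exists_homogeneousComponent_eq_bar (e := e) hI hq
  exact (mem_partialEliminationIdeal_iff hI).2 ⟨f, hf, hi, h⟩

/-- Prepending a fixed `x_0`-exponent is strictly monotone for GLex, so a larger monomial of the
coefficient would give a larger monomial of `f`. -/
theorem bar_ne_zero_and_degree {f : MvPolynomial (Fin (r + 1)) k} (hf0 : f ≠ 0) :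
    bar (d0 f) f ≠ 0 ∧ MonomialOrder.degLex.degree f =
      Finsupp.cons (d0 f) (MonomialOrder.degLex.degree (bar (d0 f) f)) := by
  set p := MonomialOrder.degLex.degree f with hp
  have hcons : p = Finsupp.cons (d0 f) p.tail := (Finsupp.cons_tail p).symm
  have hc : coeff p.tail (bar (d0 f) f) ≠ 0 := by
    rw [coeff_bar, ← hcons]
    exact MonomialOrder.degLex.coeff_degree_ne_zero_iff.2 hf0
  refine ⟨fun h => hc (by rw [h, coeff_zero]), hcons.trans (congrArg _ ?_)⟩
  refine MonomialOrder.degLex.toSyn.injective (le_antisymm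
    (MonomialOrder.degLex.le_degree (mem_support_iff.2 hc)) ?_)
  rw [MonomialOrder.degree_le_iff]
  intro s hs
  by_contra! hlt
  have h := cons_degLex_lt_cons (d0 f) hlt
  rw [← hcons, hp] at h
  rw [mem_support_iff, coeff_bar] at hs
  exact hs (MonomialOrder.degLex.coeff_eq_zero_of_lt h)

/-- A homogeneous `q` in `K_i(I)` lifts to a homogeneous element of `I` of `x_0`-degree at most `i`;
as `q ≠ 0`, the degree is exactly `i`, and the leading exponents correspond. -/
theorem mem_leadExps_partialEliminationIdeal (hI : IsHomogeneousIdeal I) {i : ℕ} {s : Fin r →₀ ℕ} :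
    s ∈ leadExps MonomialOrder.degLex (partialEliminationIdeal i I) ↔
      s.cons i ∈ leadExps MonomialOrder.degLex I := by
  constructor
  · intro hs
    obtain ⟨q, hq, hqd, hq0, rfl⟩ := exists_isHomogeneous_of_mem_leadExps
      (isHomogeneousIdeal_partialEliminationIdeal hI i) hs
    obtain ⟨f, hf, hfd, hi, hfq⟩ := exists_homogeneousComponent_eq_bar
      (e := (MonomialOrder.degLex.degree q).degree) hI hq
    rw [homogeneousComponent_eq_self hqd] at hfq
    have hf0 : f ≠ 0 := by
      rintro rfl
      exact hq0 (by rw [← hfq]; simp [bar])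
    have hd0 : d0 f = i := by
      rw [d0_eq_degreeOf hfd]
      refine le_antisymm hi ?_
      obtain ⟨t, ht⟩ := ne_zero_iff.1 (hfq ▸ hq0)
      rw [coeff_bar] at ht
      simpa using (degreeOf_le_iff (n := 0)).1 le_rfl _ (mem_support_iff.2 ht)
    refine ⟨f, hf, hf0, ?_⟩
    rw [(bar_ne_zero_and_degree hf0).2, hd0, hfq]
  · intro hs
    obtain ⟨f, hf, hfd, hf0, hfs⟩ := exists_isHomogeneous_of_mem_leadExps hI hs
    have hd0 : d0 f = i := by rw [d0, hfs, Finsupp.cons_zero]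
    obtain ⟨h1, h2⟩ := bar_ne_zero_and_degree hf0
    rw [hd0] at h1 h2
    refine ⟨bar i f, (mem_partialEliminationIdeal_iff hI).2
      ⟨f, hf, (d0_eq_degreeOf hfd).symm.trans hd0 |>.le, rfl⟩, h1, ?_⟩
    exact (Finsupp.cons_right_injective i) (h2.symm.trans hfs)

end PartialEliminationIdeals

/-! ### Coordinate changes fixing `x_0`, and generic coordinates for `K_i(I)` -/

section Border

variable {r : ℕ} {k : Type*} [Field k]

/-- The block diagonal matrix with blocks `1` and `A`. -/
def border {R : Type*} [CommRing R] : Matrix (Fin r) (Fin r) R →*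
    Matrix (Fin (r + 1)) (Fin (r + 1)) R where
  toFun A := Matrix.of fun a b =>
    Fin.cases (Fin.cases 1 (fun _ => 0) b) (fun a' => Fin.cases 0 (fun b' => A a' b') b) a
  map_one' := by
    ext a b
    refine Fin.cases ?_ (fun a => ?_) a <;> refine Fin.cases ?_ (fun b => ?_) b <;>
      simp [Matrix.one_apply, (Fin.succ_ne_zero _).symm]
  map_mul' A B := by
    ext a b
    refine Fin.cases ?_ (fun a => ?_) a <;> refine Fin.cases ?_ (fun b => ?_) b <;>
      simp [Matrix.mul_apply, Fin.sum_univ_succ]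

/-- The coordinate changes of `x_1, …, x_r` that fix `x_0`. -/
def borderGL : GL (Fin r) k →* GL (Fin (r + 1)) k := Units.map border

theorem finSuccEquiv_changeCoords_borderGL (g : GL (Fin r) k) (f : MvPolynomial (Fin (r + 1)) k) :
    finSuccEquiv k r (changeCoords (borderGL g) f) =
      (finSuccEquiv k r f).map (changeCoords g : MvPolynomial (Fin r) k →+* _) := by
  induction f using MvPolynomial.induction_on with
  | C c => simp [finSuccEquiv_apply]
  | add f g hf hg => rw [map_add, map_add, hf, hg, map_add, Polynomial.map_add]
  | mul_X f l hf =>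
    rw [map_mul, map_mul, hf, map_mul, Polynomial.map_mul]
    refine congrArg _ ?_
    refine Fin.cases ?_ (fun l => ?_) l
    · rw [finSuccEquiv_X_zero, Polynomial.map_X, changeCoords_X, Fin.sum_univ_succ]
      simp [borderGL, border, finSuccEquiv_apply]
    · rw [finSuccEquiv_X_succ, Polynomial.map_C, changeCoords_X, Fin.sum_univ_succ]
      simp [borderGL, border, finSuccEquiv_apply, changeCoords_X]

theorem bar_changeCoords_borderGL (g : GL (Fin r) k) (i : ℕ) (f : MvPolynomial (Fin (r + 1)) k) :
    bar i (changeCoords (borderGL g) f) = changeCoords g (bar i f) := by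
  rw [bar, finSuccEquiv_changeCoords_borderGL, Polynomial.coeff_map]
  rfl

theorem degreeOf_changeCoords_borderGL_le (g : GL (Fin r) k) (f : MvPolynomial (Fin (r + 1)) k) :
    degreeOf 0 (changeCoords (borderGL g) f) ≤ degreeOf 0 f := by
  rw [← natDegree_finSuccEquiv, ← natDegree_finSuccEquiv, finSuccEquiv_changeCoords_borderGL]
  exact Polynomial.natDegree_map_le

theorem partialEliminationIdeal_map_borderGL {I : Ideal (MvPolynomial (Fin (r + 1)) k)}
    (hI : IsHomogeneousIdeal I) (g : GL (Fin r) k) (i : ℕ) :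
    (partialEliminationIdeal i I).map (changeCoords g) =
      partialEliminationIdeal i (I.map (changeCoords (borderGL g))) := by
  ext q
  rw [mem_map_changeCoords, mem_partialEliminationIdeal_iff hI,
    mem_partialEliminationIdeal_iff (isHomogeneousIdeal_map_changeCoords hI _)]
  constructor
  · rintro ⟨f, hf, hi, hq⟩
    refine ⟨changeCoords (borderGL g) f, Ideal.mem_map_of_mem _ hf,
      (degreeOf_changeCoords_borderGL_le g f).trans hi, ?_⟩
    rw [bar_changeCoords_borderGL, hq, changeCoords_apply_inv]
  · rintro ⟨f, hf, hi, rfl⟩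
    rw [mem_map_changeCoords, ← map_inv] at hf
    exact ⟨_, hf, (degreeOf_changeCoords_borderGL_le _ f).trans hi, bar_changeCoords_borderGL _ _ _⟩

/-- Pulls a Zariski open condition on `GL_{r+1}` back to `GL_r`. -/
theorem aeval_entries_borderGL (g : GL (Fin r) k)
    (P : MvPolynomial (Fin (r + 1) × Fin (r + 1)) k) :
    aeval (entries (borderGL g)) P = aeval (entries g)
      (aeval (fun p => border (Matrix.mvPolynomialX (Fin r) (Fin r) k) p.1 p.2) P) := by
  rw [← AlgHom.comp_apply]
  congr 1
  ext ⟨a, b⟩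
  rw [AlgHom.comp_apply, aeval_X, aeval_X]
  refine Fin.cases ?_ (fun a => ?_) a <;> refine Fin.cases ?_ (fun b => ?_) b <;>
    simp [entries, borderGL, border]

theorem inGenericCoordinates_partialEliminationIdeal [Infinite k]
    {I : Ideal (MvPolynomial (Fin (r + 1)) k)} (hI : IsHomogeneousIdeal I)
    (hgen : InGenericCoordinates I) (i : ℕ) :
    InGenericCoordinates (partialEliminationIdeal i I) := by
  obtain ⟨P, hP1, hP⟩ := exists_polynomial_leadExps hI hgen
  set Q := aeval (fun p => border (Matrix.mvPolynomialX (Fin r) (Fin r) k) p.1 p.2) P with hQ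
  have hzero : ∀ x : Fin r × Fin r → k,
      x ∉ zeroLocus k (Ideal.span {Q}) ↔ aeval x Q ≠ 0 := by
    intro x
    rw [zeroLocus_span]
    simp
  -- The pulled-back open set is nonempty because it contains the identity.
  refine ⟨_, ⟨Ideal.span {Q}, rfl⟩, ⟨1, (hzero (entries 1)).2 ?_⟩, fun g hg => ?_⟩
  · rwa [← aeval_entries_borderGL, map_one]
  · have hg' := (hzero (entries g)).1 hg
    rw [← aeval_entries_borderGL] at hg'
    rw [initialIdeal_eq_iff, partialEliminationIdeal_map_borderGL hI]
    ext s
    rw [mem_leadExps_partialEliminationIdeal hI, mem_leadExps_partialEliminationIdeal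
      (isHomogeneousIdeal_map_changeCoords hI _), hP _ hg']

end Border

/-! ### The Gröbner basis of `K_i(I)` -/

section GroebnerBasis

variable {r : ℕ} {k : Type*} [Field k] [CharZero k] {I : Ideal (MvPolynomial (Fin (r + 1)) k)}

theorem exists_mem_groebnerBasis_d0_eq (hI : IsHomogeneousIdeal I) (hgen : InGenericCoordinates I)
    {G : Set (MvPolynomial (Fin (r + 1)) k)}
    (hG : IsHomogeneousGroebnerBasis MonomialOrder.degLex I G) {i : ℕ}
    (hi : ∀ j < i, ∀ f ∈ I, f.IsHomogeneous j → f = 0) (s : Fin r →₀ ℕ)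
    (hs : s.cons i ∈ leadExps MonomialOrder.degLex I) :
    ∃ f ∈ G, f ≠ 0 ∧ d0 f = i ∧ MonomialOrder.degLex.degree f ≤ s.cons i := by
  induction hN : s.degree using Nat.strong_induction_on generalizing s with
  | _ N ih =>
  subst hN
  obtain ⟨-, hGI, hGhom, hspan⟩ := hG
  have hmem := monomial_mem_initialIdeal_iff.2 hs
  rw [← hspan, monomial_mem_span_leadingTerm_iff] at hmem
  obtain ⟨f, hfG, hf0, hle⟩ := hmem
  set w := MonomialOrder.degLex.degree f with hw
  have hw0 : w 0 ≤ i := by simpa using hle 0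
  rcases hw0.eq_or_lt with h | hlt
  · exact ⟨f, hfG, hf0, h, hle⟩
  obtain ⟨d, hd⟩ := hGhom f hfG
  have hwd : w.degree = d := (hd.degree_eq_sum_deg_support
    (MonomialOrder.degLex.degree_mem_support hf0)).symm
  have hid : i ≤ d := by
    by_contra! h
    exact hf0 (hi d h f (hGI hfG) hd)
  -- The degree of `w` is at least `i` while `w 0 < i`, so some variable other than `x_0` divides
  -- the leading monomial of `f`.
  obtain ⟨l, hl⟩ : ∃ l : Fin r, w l.succ ≠ 0 := by
    by_contra! h
    rw [Finsupp.degree_eq_sum, Fin.sum_univ_succ] at hwd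
    simp only [h, Finset.sum_const_zero] at hwd
    omega
  have hwl : w - Finsupp.single l.succ 1 + Finsupp.single l.succ 1 = w :=
    tsub_add_cancel_of_le (Finsupp.single_le_iff.2 (Nat.one_le_iff_ne_zero.2 hl))
  have hex := add_single_mem_leadExps hI hgen (Fin.succ_pos l)
    (u := w - Finsupp.single l.succ 1) (by rw [hwl]; exact ⟨f, hGI hfG, hf0, rfl⟩)
  have hsl : w l.succ ≤ s l := by simpa using hle l.succ
  -- After the exchange the `x_0`-exponent is `w 0 + 1 ≤ i` and one factor `x_{l+1}` is gone, so the
  -- new leading monomial still divides when that factor is also removed from `s`.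
  have hs' : (s - Finsupp.single l 1).cons i ∈ leadExps MonomialOrder.degLex I := by
    refine mem_leadExps_of_le hex fun a => ?_
    refine Fin.cases ?_ (fun a => ?_) a
    · simpa using hlt
    · have := hle a.succ
      rw [Finsupp.cons_succ] at this
      simp only [Finsupp.add_apply, Finsupp.tsub_apply, Finsupp.cons_succ, Finsupp.single_apply,
        Fin.succ_inj]
      rw [if_neg (Fin.succ_ne_zero a).symm]
      omega
  have hsl' : s - Finsupp.single l 1 + Finsupp.single l 1 = s :=
    tsub_add_cancel_of_le (Finsupp.single_le_iff.2 (by omega))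
  have hdeg : (s - Finsupp.single l 1).degree < s.degree := by
    conv_rhs => rw [← hsl', map_add]
    simp
  obtain ⟨f', h1, h2, h3, h4⟩ := ih _ hdeg _ hs' rfl
  refine ⟨f', h1, h2, h3, h4.trans fun a => ?_⟩
  refine Fin.cases ?_ (fun a => ?_) a <;> simp

theorem isHomogeneousGroebnerBasis_partialEliminationIdeal (hI : IsHomogeneousIdeal I)
    (hgen : InGenericCoordinates I) {G : Set (MvPolynomial (Fin (r + 1)) k)}
    (hG : IsHomogeneousGroebnerBasis MonomialOrder.degLex I G) {i : ℕ}
    (hi : ∀ j < i, ∀ f ∈ I, f.IsHomogeneous j → f = 0) :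
    IsHomogeneousGroebnerBasis MonomialOrder.degLex (partialEliminationIdeal i I)
      {q | ∃ f ∈ G, f ≠ 0 ∧ d0 f = i ∧ q = bar i f} := by
  refine ⟨(hG.1.image (bar i)).subset ?_, ?_, ?_, ?_⟩
  · rintro _ ⟨f, hf, -, -, rfl⟩
    exact ⟨f, hf, rfl⟩
  · rintro _ ⟨f, hf, -, rfl, rfl⟩
    obtain ⟨d, hd⟩ := hG.2.2.1 f hf
    exact (mem_partialEliminationIdeal_iff hI).2
      ⟨f, hG.2.1 hf, (d0_eq_degreeOf hd).ge, rfl⟩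
  · rintro _ ⟨f, hf, hf0, rfl, rfl⟩
    obtain ⟨d, hd⟩ := hG.2.2.1 f hf
    have hle : d0 f ≤ d := by
      rw [hd.degree_eq_sum_deg_support (MonomialOrder.degLex.degree_mem_support hf0)]
      exact Finsupp.le_degree 0 _
    exact ⟨_, hd.finSuccEquiv_coeff_isHomogeneous (d0 f) (d - d0 f) (by omega)⟩
  · refine span_leadingTerm_eq_initialIdeal ?_ fun s hs => ?_
    · rintro _ ⟨f, hf, -, rfl, rfl⟩
      obtain ⟨d, hd⟩ := hG.2.2.1 f hf
      exact (mem_partialEliminationIdeal_iff hI).2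
        ⟨f, hG.2.1 hf, (d0_eq_degreeOf hd).ge, rfl⟩
    · obtain ⟨f, hf, hf0, rfl, hle⟩ := exists_mem_groebnerBasis_d0_eq hI hgen hG hi s
        ((mem_leadExps_partialEliminationIdeal hI).1 hs)
      obtain ⟨h1, h2⟩ := bar_ne_zero_and_degree hf0
      refine ⟨_, ⟨f, hf, hf0, rfl, rfl⟩, h1, fun a => ?_⟩
      rw [h2] at hle
      simpa using hle a.succ

end GroebnerBasis

end

end PartialElimination

theorem mainTheorem6 {k : Type*} [Field k] [IsAlgClosed k] [CharZero k] {r : ℕ}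
    (I : Ideal (MvPolynomial (Fin (r + 1)) k))
    (hI : PartialElimination.IsHomogeneousIdeal I)
    (hgen : PartialElimination.InGenericCoordinates I)
    (G : Set (MvPolynomial (Fin (r + 1)) k))
    (hG : PartialElimination.IsHomogeneousGroebnerBasis MonomialOrder.degLex I G)
    (i : ℕ) :
    (PartialElimination.IsHomogeneousIdeal (PartialElimination.partialEliminationIdeal i I) ∧
      PartialElimination.InGenericCoordinates (PartialElimination.partialEliminationIdeal i I)) ∧
    ((∀ j < i, ∀ f ∈ I, f.IsHomogeneous j → f = 0) →
      PartialElimination.IsHomogeneousGroebnerBasis MonomialOrder.degLex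
        (PartialElimination.partialEliminationIdeal i I)
        {q | ∃ f ∈ G, f ≠ 0 ∧ PartialElimination.d0 f = i ∧ q = PartialElimination.bar i f}) := by
  have hinf : Infinite k := inferInstance
  exact ⟨⟨PartialElimination.isHomogeneousIdeal_partialEliminationIdeal hI i,
    PartialElimination.inGenericCoordinates_partialEliminationIdeal hI hgen i⟩,
    PartialElimination.isHomogeneousGroebnerBasis_partialEliminationIdeal hI hgen hG⟩
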